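/- Let $\Lambda\in\mathbb R^{d\times d}$ be symmetric positive definite ($d\ge 1$), with smallest eigenvalue $\lambda_{\min}(\Lambda)$, put $\mathrm{Hard}(\Lambda)=\operatorname{tr}(\Lambda)/\lambda_{\min}(\Lambda)$, and for $n\ge 1$ let $\Gamma=(1+\frac1n)\Lambda+\frac1n\operatorname{tr}(\Lambda)I$. Consider the linear self-attention map $f(E)=E+V_*E\cdot\frac{E^\top W_*E}{m}$ acting on matrices $E$ with $2d+2$ rows, grouped in blocks of sizes $d,1,d,1$. Here, for some real $c\ne 0$, the only nonzero block of $V_*$ is the $(3,1)$ block $-\Gamma^{-1}/c$, and the only nonzero blocks of $W_*$ are the $(1,3)$ block $cI$ and the $(2,4)$ block $-c$. (These are the parameters reached by training on prompts of length $n$ with features from $N(0,\Lambda)$.) Let $x_1,\dots,x_m\sim N(0,\Lambda)$ and $w_{\rm test}\sim N(0,I_d)$ be independent. Starting from $w_0=0$, let $E_i$ be the matrix with columns $(x_j,\langle w_{\rm test},x_j\rangle,0,0)$, $1\le j\le m$, followed by $(0,0,w_l,1)$, $0\le l\le i$, and let $w_{i+1}$ be the third block of the last column of $f(E_i)$ (test-time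 chain of thought). (1) For all constants $0<a\le b$, $R>0$ and $\kappa>0$ there is a constant $C>0$, depending only on these, such that the following holds for all $d,n,m,k\ge 1$, all $c\neq 0$ and all $\Lambda$ as above. If the eigenvalues of $\Lambda$ lie in $[a,b]$, $n\le R\,d$, and $m\ge\kappa\,k^2d$, then $\|w_{k+1}-w_{\rm test}\|^2$ is integrable and $$\mathbb E\,\|w_{k+1}-w_{\rm test}\|^2\;\le\; d\Bigl(1+\frac{n}{1+\mathrm{Hard}(\Lambda)}\Bigr)^{-2k}\Bigl(1+C\,k\sqrt{d/m}\Bigr).$$ The last factor is thus $1+o(1)$ as $k\sqrt{d/m}\to 0$, uniformly over this class. The same bound, with the same right-hand side, holds for $\mathbb E\,\|w_k-w_{\rm test}\|^2$. (2) For all $d,n\ge1$ and all symmetric positive definite $\Lambda\in\mathbb R^{d\times d}$, the factor $\bigl(1+\frac{n}{1+\mathrm{Hard}(\Lambda)}\bigr)^{-1}$ lies strictly between $0$ and $1$, so the leading term of the bound decays exponentially in $k$. For fixed $n$, the factor is strictly increasing in $\mathrm{Hard}(\Lambda)$ (also across different dimensions $d$), so it decays more slowly for harder tasks. -/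

import Mathlib

open MeasureTheory ProbabilityTheory Matrix

noncomputable section

namespace ICL

/-- The rows of an embedding matrix: `d` feature coordinates, one label coordinate, `d` coordinates
of a weight estimate, and one constant coordinate, in this order. -/
abbrev Token (d : ℕ) : Type := (Fin d ⊕ Unit) ⊕ (Fin d ⊕ Unit)

/-- Linear self-attention with residual connection:
`f_LSA(E; V, W) = E + V E (Eᵀ W E) / ρ`. -/
def lsa {d : ℕ} {ι : Type} [Fintype ι] (ρ : ℝ) (V W : Matrix (Token d) (Token d) ℝ)
    (E : Matrix (Token d) ι ℝ) : Matrix (Token d) ι ℝ :=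
  E + V * E * (ρ⁻¹ • (Eᵀ * W * E))

/-- `Γ = (1 + 1/n) Λ + (1/n) tr(Λ) I`, where `n` is the number of in-context examples in a
training prompt. -/
def gammaMat {d : ℕ} (n : ℕ) (Λ : Matrix (Fin d) (Fin d) ℝ) : Matrix (Fin d) (Fin d) ℝ :=
  (1 + 1 / (n : ℝ)) • Λ + ((1 / (n : ℝ)) * Λ.trace) • (1 : Matrix (Fin d) (Fin d) ℝ)

/-- The trained parameter `V_*`: its only nonzero block is the (weight, feature) block `-Γ⁻¹ / c`. -/
def vStar {d : ℕ} (n : ℕ) (c : ℝ) (Λ : Matrix (Fin d) (Fin d) ℝ) :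
    Matrix (Token d) (Token d) ℝ :=
  fromBlocks 0 0 (fromBlocks (-(c⁻¹ • (gammaMat n Λ)⁻¹)) 0 0 0) 0

/-- The trained parameter `W_*`: its only nonzero blocks are the (feature, weight) block `c I` and
the (label, constant) block `-c`. -/
def wStar (d : ℕ) (c : ℝ) : Matrix (Token d) (Token d) ℝ :=
  fromBlocks 0 (fromBlocks (c • (1 : Matrix (Fin d) (Fin d) ℝ)) 0 0 (of fun _ _ => -c)) 0 0

/-- The noiseless label `⟨w, x⟩`. -/
def label {d : ℕ} (w x : EuclideanSpace ℝ (Fin d)) : ℝ := inner ℝ w x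

/-- The embedding of the test prompt `(x_j, ⟨w, x_j⟩)`, `j < m`, followed by the `i + 1` estimates
generated so far. The first `m` columns are `(x_j, ⟨w, x_j⟩, 0, 0)`, the others `(0, 0, v_l, 1)`. -/
def embedding {d m i : ℕ} (x : Fin m → EuclideanSpace ℝ (Fin d)) (w : EuclideanSpace ℝ (Fin d))
    (v : Fin (i + 1) → EuclideanSpace ℝ (Fin d)) :
    Matrix (Token d) (Fin m ⊕ Fin (i + 1)) ℝ :=
  fromBlocks (fromRows (of fun r j => x j r) (of fun _ j => label w (x j))) 0
    0 (fromRows (of fun r l => v l r) (of fun _ _ => 1))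

/-- The estimate output by the model with parameters `V_*`, `W_*` on an embedding: the weight
coordinates of the last column of `f_LSA`. The scaling `ρ` is the length `m` of the prompt. -/
def readout {d m i : ℕ} (n : ℕ) (c : ℝ) (Λ : Matrix (Fin d) (Fin d) ℝ)
    (E : Matrix (Token d) (Fin m ⊕ Fin (i + 1)) ℝ) : EuclideanSpace ℝ (Fin d) :=
  WithLp.toLp 2 fun r =>
    lsa (m : ℝ) (vStar n c Λ) (wStar d c) E (Sum.inr (Sum.inl r)) (Sum.inr (Fin.last i))

/-- The test-time chain of thought `(w_0, …, w_i)`: it starts at `w_0 = 0`, and every new estimate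
is read out from the embedding that contains all the earlier ones, and then appended to it. -/
def chain {d m : ℕ} (n : ℕ) (c : ℝ) (Λ : Matrix (Fin d) (Fin d) ℝ)
    (x : Fin m → EuclideanSpace ℝ (Fin d)) (w : EuclideanSpace ℝ (Fin d)) :
    (i : ℕ) → Fin (i + 1) → EuclideanSpace ℝ (Fin d)
  | 0 => fun _ => 0
  | i + 1 => Fin.snoc (α := fun _ => EuclideanSpace ℝ (Fin d)) (chain n c Λ x w i)
      (readout n c Λ (embedding x w (chain n c Λ x w i)))

/-- The `i`-th estimate `w_i` of the chain of thought. -/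
def estimate {d m : ℕ} (n : ℕ) (c : ℝ) (Λ : Matrix (Fin d) (Fin d) ℝ) (i : ℕ)
    (x : Fin m → EuclideanSpace ℝ (Fin d)) (w : EuclideanSpace ℝ (Fin d)) :
    EuclideanSpace ℝ (Fin d) :=
  chain n c Λ x w i (Fin.last i)

/-- The law of the test data `(x_1, …, x_m, w_test)`: independent, with `x_j ∼ N(0, Λ)` and
`w_test ∼ N(0, I)`. -/
def testLaw {d : ℕ} (m : ℕ) (Λ : Matrix (Fin d) (Fin d) ℝ) :
    Measure ((Fin m → EuclideanSpace ℝ (Fin d)) × EuclideanSpace ℝ (Fin d)) :=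
  (Measure.pi fun _ : Fin m => multivariateGaussian 0 Λ).prod
    (multivariateGaussian 0 (1 : Matrix (Fin d) (Fin d) ℝ))

/-- The squared Euclidean estimation error `‖w_i - w_test‖²`, as a function of the test data. -/
def sqError {d m : ℕ} (n : ℕ) (c : ℝ) (Λ : Matrix (Fin d) (Fin d) ℝ) (i : ℕ)
    (p : (Fin m → EuclideanSpace ℝ (Fin d)) × EuclideanSpace ℝ (Fin d)) : ℝ :=
  ‖estimate n c Λ i p.1 p.2 - p.2‖ ^ 2

/-- The smallest eigenvalue of a symmetric matrix. -/
def lambdaMin {d : ℕ} (Λ : Matrix (Fin d) (Fin d) ℝ) : ℝ := sInf (spectrum ℝ Λ)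

/-- The hardness `tr(Λ) / λ_min(Λ)` of the task with feature covariance `Λ`. -/
def hard {d : ℕ} (Λ : Matrix (Fin d) (Fin d) ℝ) : ℝ := Λ.trace / lambdaMin Λ

/-- The decay factor `(1 + n / (1 + Hard(Λ)))⁻¹` of one step of the chain of thought. -/
def decayRate {d : ℕ} (n : ℕ) (Λ : Matrix (Fin d) (Fin d) ℝ) : ℝ :=
  (1 + (n : ℝ) / (1 + hard Λ))⁻¹

end ICL

end

/-! One attention pass is a preconditioned gradient step: with Ĉ the sample covariance, the error is
multiplied by 1 - Γ⁻¹Ĉ, so after i steps it is -(1 - Γ⁻¹Ĉ)^i w (`estimate_sub`). With Λ in place of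
Ĉ this operator is diagonal in the eigenbasis of Λ and its norm is at most the decay rate ρ
(`norm_one_sub_gammaMat_inv_mul_le`). Since n ≤ R d keeps ρ ≥ 1/(1+R), the perturbation Γ⁻¹(Ĉ - Λ)
can be measured relative to ρ, and the squared error is at most ρ^(2i) (1 + β‖Ĉ - Λ‖)^(2i) ‖w‖² with
β = (1+R)R/a (`sqError_le`). Independence and E‖w‖² = d reduce the claim to a moment of order 2i of
1 + β‖Ĉ - Λ‖ (`exists_integral_one_add_norm_pow_le`).

That moment is bounded through exponential moments. Averaging exponentials of the quadratic form
over a ball dominates the exponential of the operator norm, at the price of a factor of order 3^d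
(`lintegral_exp_norm_sampleCov_sub_le`). Convexity of exp then transfers the bound from one large
exponent to all smaller ones, turning exp(O(d)) into exp(O(s √(d/m)))
(`integrable_exp_norm_sampleCov_sub_and_integral_le`); s of order k gives 1 + O(k √(d/m)). -/

namespace ICL

/-! ### The attention step as a linear iteration -/

/-- The sample second-moment operator `v ↦ m⁻¹ ∑ⱼ ⟨xⱼ, v⟩ xⱼ`. -/
noncomputable def sampleCov {d m : ℕ} (x : Fin m → EuclideanSpace ℝ (Fin d)) :
    EuclideanSpace ℝ (Fin d) →L[ℝ] EuclideanSpace ℝ (Fin d) :=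
  (m : ℝ)⁻¹ • ∑ j, (innerSL ℝ (x j)).smulRight (x j)

theorem sampleCov_apply {d m : ℕ} (x : Fin m → EuclideanSpace ℝ (Fin d))
    (v : EuclideanSpace ℝ (Fin d)) :
    sampleCov x v = (m : ℝ)⁻¹ • ∑ j, inner ℝ (x j) v • x j := by
  simp [sampleCov]

/-- The last column of EᵀWE pairs each example with the newest estimate and equals c times the
residual there. The columns of earlier estimates have zero feature block, so V kills them; the two
factors of c cancel. -/
theorem readout_embedding {d m i : ℕ} (n : ℕ) {c : ℝ} (hc : c ≠ 0)
    (Λ : Matrix (Fin d) (Fin d) ℝ) (x : Fin m → EuclideanSpace ℝ (Fin d))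
    (w : EuclideanSpace ℝ (Fin d)) (v : Fin (i + 1) → EuclideanSpace ℝ (Fin d)) :
    readout n c Λ (embedding x w v) =
      v (Fin.last i) - toEuclideanCLM (𝕜 := ℝ) (gammaMat n Λ)⁻¹
        (sampleCov x (v (Fin.last i) - w)) := by
  ext r
  have hj : ∀ j, inner ℝ (x j) (v (Fin.last i) - w) =
      ∑ s, x j s * v (Fin.last i) s - label w (x j) := by
    intro j
    rw [inner_sub_right, label, real_inner_comm w, real_inner_comm (v _)]
    simp [PiLp.inner_apply, mul_comm]
  simp only [readout, lsa, embedding, vStar, wStar, fromBlocks_multiply, fromBlocks_transpose,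
    fromBlocks_smul, Matrix.mul_zero, Matrix.zero_mul, add_zero, zero_add, Matrix.transpose_zero,
    smul_zero, fromBlocks_add]
  rw [sampleCov_apply]
  simp only [hj]
  simp only [fromBlocks_apply₂₂]
  have h1 : ∀ j, ∑ s, c⁻¹ * (gammaMat n Λ)⁻¹ r s * x j s =
      c⁻¹ * ∑ s, (gammaMat n Λ)⁻¹ r s * x j s := fun j => by
    rw [Finset.mul_sum]; simp only [mul_assoc]
  have h2 : ∀ j, ∑ s, x j s * c * v (Fin.last i) s + -(label w (x j) * c) =
      c * (∑ s, x j s * v (Fin.last i) s - label w (x j)) := fun j => by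
    rw [mul_sub, Finset.mul_sum]
    simp only [mul_comm _ c, mul_assoc, sub_eq_add_neg]
  simp [Matrix.mul_apply, mulVec, dotProduct, Matrix.one_apply, h1, h2]
  rw [sub_eq_add_neg]
  congr 3
  refine Finset.sum_congr rfl fun j _ => ?_
  field_simp

theorem estimate_succ_sub {d m : ℕ} (n : ℕ) {c : ℝ} (hc : c ≠ 0)
    (Λ : Matrix (Fin d) (Fin d) ℝ) (x : Fin m → EuclideanSpace ℝ (Fin d))
    (w : EuclideanSpace ℝ (Fin d)) (i : ℕ) :
    estimate n c Λ (i + 1) x w - w =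
      (1 - toEuclideanCLM (𝕜 := ℝ) (gammaMat n Λ)⁻¹ * sampleCov x) (estimate n c Λ i x w - w) := by
  have h : estimate n c Λ (i + 1) x w = readout n c Λ (embedding x w (chain n c Λ x w i)) := by
    simp [estimate, chain]
  rw [h, readout_embedding n hc]
  simp [estimate]
  abel

theorem estimate_sub {d m : ℕ} (n : ℕ) {c : ℝ} (hc : c ≠ 0)
    (Λ : Matrix (Fin d) (Fin d) ℝ) (x : Fin m → EuclideanSpace ℝ (Fin d))
    (w : EuclideanSpace ℝ (Fin d)) (i : ℕ) :
    estimate n c Λ i x w - w =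
      -(((1 - toEuclideanCLM (𝕜 := ℝ) (gammaMat n Λ)⁻¹ * sampleCov x) ^ i) w) := by
  induction i with
  | zero => simp [estimate, chain]
  | succ i ih => rw [estimate_succ_sub n hc, ih, pow_succ', map_neg, mul_apply_eq_comp]

/-! ### Spectral bounds for Γ⁻¹ and 1 - Γ⁻¹Λ -/

theorem norm_le_of_orthonormalBasis_eigenvectors {ι E : Type*} [Fintype ι] [NormedAddCommGroup E]
    [InnerProductSpace ℝ E] (b : OrthonormalBasis ι ℝ E) (T : E →L[ℝ] E) {μ : ι → ℝ}
    (hT : ∀ i, T (b i) = μ i • b i) {K : ℝ} (hK : 0 ≤ K) (hμ : ∀ i, |μ i| ≤ K) : ‖T‖ ≤ K := by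
  refine T.opNorm_le_bound hK fun v => ?_
  have hTv : T v = ∑ i, (μ i * inner ℝ (b i) v) • b i := by
    conv_lhs => rw [← b.sum_repr' v]
    simp [map_sum, hT, smul_smul, mul_comm]
  have h1 : ‖T v‖ ^ 2 = ∑ i, (μ i * inner ℝ (b i) v) ^ 2 := by
    rw [hTv, ← real_inner_self_eq_norm_sq, b.orthonormal.inner_sum]
    simp [pow_two]
  have h2 : ‖T v‖ ^ 2 ≤ (K * ‖v‖) ^ 2 := by
    rw [h1, mul_pow, ← b.sum_sq_inner_right v, Finset.mul_sum]
    refine Finset.sum_le_sum fun i _ => ?_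
    rw [mul_pow]
    exact mul_le_mul_of_nonneg_right
      (sq_le_sq' (by linarith [(abs_le.1 (hμ i)).1]) (abs_le.1 (hμ i)).2) (sq_nonneg _)
  exact le_of_sq_le_sq h2 (by positivity)

section Spectral

variable {d : ℕ} {Λ : Matrix (Fin d) (Fin d) ℝ}

theorem toEuclideanCLM_eigenvectorBasis (hΛ : Λ.IsHermitian) (i : Fin d) :
    toEuclideanCLM (𝕜 := ℝ) Λ (hΛ.eigenvectorBasis i) =
      hΛ.eigenvalues i • hΛ.eigenvectorBasis i := by
  ext r
  have := congrFun (hΛ.mulVec_eigenvectorBasis i) r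
  simpa using this

theorem lambdaMin_le (hΛ : Λ.IsHermitian) (i : Fin d) : lambdaMin Λ ≤ hΛ.eigenvalues i :=
  csInf_le (Matrix.finite_real_spectrum).bddBelow (hΛ.eigenvalues_mem_spectrum_real i)

theorem trace_eq_sum (hΛ : Λ.IsHermitian) : Λ.trace = ∑ i, hΛ.eigenvalues i := by
  simpa using hΛ.trace_eq_sum_eigenvalues

theorem lambdaMin_pos (hd : 1 ≤ d) (hΛ : Λ.PosDef) : 0 < lambdaMin Λ := by
  -- For d = 0 the spectrum is empty and its `sInf` is the default value 0.
  have : Nonempty (Fin d) := ⟨⟨0, hd⟩⟩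
  have hne : (spectrum ℝ Λ).Nonempty :=
    ⟨_, hΛ.1.eigenvalues_mem_spectrum_real (Classical.arbitrary _)⟩
  have h := hne.csInf_mem (Matrix.finite_real_spectrum (A := Λ))
  rw [hΛ.1.spectrum_real_eq_range_eigenvalues] at h
  obtain ⟨i, hi⟩ := h
  rw [lambdaMin, hΛ.1.spectrum_real_eq_range_eigenvalues, ← hi]
  exact hΛ.eigenvalues_pos i

theorem card_mul_le_trace (hΛ : Λ.IsHermitian) {a : ℝ} (ha : ∀ i, a ≤ hΛ.eigenvalues i) :
    d * a ≤ Λ.trace := by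
  rw [trace_eq_sum hΛ]
  simpa using Finset.card_nsmul_le_sum Finset.univ hΛ.eigenvalues a fun i _ => ha i

theorem card_le_hard (hd : 1 ≤ d) (hΛ : Λ.PosDef) : (d : ℝ) ≤ hard Λ := by
  rw [hard, le_div_iff₀ (lambdaMin_pos hd hΛ)]
  exact card_mul_le_trace hΛ.1 (lambdaMin_le hΛ.1)

theorem trace_pos (hd : 1 ≤ d) (hΛ : Λ.PosDef) : 0 < Λ.trace := by
  have : Nonempty (Fin d) := ⟨⟨0, hd⟩⟩
  exact hΛ.trace_pos

theorem hard_pos (hd : 1 ≤ d) (hΛ : Λ.PosDef) : 0 < hard Λ :=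
  div_pos (trace_pos hd hΛ) (lambdaMin_pos hd hΛ)

theorem decayRate_pos (n : ℕ) (hd : 1 ≤ d) (hΛ : Λ.PosDef) : 0 < decayRate n Λ := by
  have := hard_pos hd hΛ
  unfold decayRate
  positivity

theorem decayRate_lt_one {n : ℕ} (hn : 1 ≤ n) (hd : 1 ≤ d) (hΛ : Λ.PosDef) :
    decayRate n Λ < 1 := by
  have := hard_pos hd hΛ
  have hn' : (0 : ℝ) < n := by exact_mod_cast hn
  exact inv_lt_one_of_one_lt₀ (by simpa using by positivity)

theorem decayRate_lt_decayRate {d' n : ℕ} {Λ' : Matrix (Fin d') (Fin d') ℝ} (hn : 1 ≤ n)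
    (h : 0 < hard Λ) (hlt : hard Λ < hard Λ') : decayRate n Λ < decayRate n Λ' := by
  have hn' : (0 : ℝ) < n := by exact_mod_cast hn
  have : 0 < hard Λ' := h.trans hlt
  unfold decayRate
  gcongr

/-- Hard(Λ) is at least d, so n/(1 + Hard(Λ)) ≤ R. This lower bound lets the decay rate be factored
out of the perturbation term in `sqError_le`. -/
theorem inv_le_decayRate {n : ℕ} {R : ℝ} (hR : 0 < R) (hn : (n : ℝ) ≤ R * d) (hd : 1 ≤ d)
    (hΛ : Λ.PosDef) : (1 + R)⁻¹ ≤ decayRate n Λ := by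
  have := hard_pos hd hΛ
  have h2 := card_le_hard hd hΛ
  have : (n : ℝ) / (1 + hard Λ) ≤ R := by
    rw [div_le_iff₀ (by positivity)]
    nlinarith
  unfold decayRate
  gcongr

theorem toEuclideanCLM_gammaMat_inv_eigenvectorBasis {n : ℕ} (hn : 1 ≤ n) (hd : 1 ≤ d)
    (hΛ : Λ.PosDef) (i : Fin d) :
    toEuclideanCLM (𝕜 := ℝ) (gammaMat n Λ)⁻¹ (hΛ.1.eigenvectorBasis i) =
      ((n : ℝ) / ((n + 1) * hΛ.1.eigenvalues i + Λ.trace)) • hΛ.1.eigenvectorBasis i := by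
  have hn' : (0 : ℝ) < n := by exact_mod_cast hn
  have htr := trace_pos hd hΛ
  have hev := hΛ.eigenvalues_pos i
  have hpos : (gammaMat n Λ).PosDef :=
    (hΛ.smul (by positivity)).add (Matrix.PosDef.one.smul (by positivity))
  have hdet : IsUnit (gammaMat n Λ).det := isUnit_iff_ne_zero.2 hpos.det_pos.ne'
  have h1 : toEuclideanCLM (𝕜 := ℝ) (gammaMat n Λ) (hΛ.1.eigenvectorBasis i) =
      (((n + 1) * hΛ.1.eigenvalues i + Λ.trace) / n) • hΛ.1.eigenvectorBasis i := by
    simp only [gammaMat, map_add, map_smul, map_one, _root_.add_apply,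
      _root_.smul_apply, toEuclideanCLM_eigenvectorBasis,
      one_apply_eq_self, smul_smul, ← add_smul]
    congr 1
    field_simp
  have h2 : toEuclideanCLM (𝕜 := ℝ) (gammaMat n Λ)⁻¹
      (toEuclideanCLM (𝕜 := ℝ) (gammaMat n Λ) (hΛ.1.eigenvectorBasis i)) =
      hΛ.1.eigenvectorBasis i := by
    rw [← mul_apply_eq_comp, ← map_mul, Matrix.nonsing_inv_mul _ hdet, map_one,
      one_apply_eq_self]
  rw [h1, map_smul] at h2
  nth_rewrite 2 [← h2]
  rw [smul_smul]
  field_simp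
  simp

theorem norm_gammaMat_inv_le {n : ℕ} (hn : 1 ≤ n) (hd : 1 ≤ d) (hΛ : Λ.PosDef) :
    ‖toEuclideanCLM (𝕜 := ℝ) (gammaMat n Λ)⁻¹‖ ≤ n / Λ.trace := by
  have htr := trace_pos hd hΛ
  refine norm_le_of_orthonormalBasis_eigenvectors hΛ.1.eigenvectorBasis _
    (toEuclideanCLM_gammaMat_inv_eigenvectorBasis hn hd hΛ) (by positivity) fun i => ?_
  have hev := hΛ.eigenvalues_pos i
  rw [abs_of_nonneg (by positivity)]
  gcongr
  simpa using by positivity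

/-- The eigenvalues (λ + tr Λ)/((n+1)λ + tr Λ) decrease in λ, so the smallest λ gives the largest
one; dividing through by λ_min there yields the decay rate. -/
theorem norm_one_sub_gammaMat_inv_mul_le {n : ℕ} (hn : 1 ≤ n) (hd : 1 ≤ d) (hΛ : Λ.PosDef) :
    ‖1 - toEuclideanCLM (𝕜 := ℝ) (gammaMat n Λ)⁻¹ * toEuclideanCLM (𝕜 := ℝ) Λ‖ ≤
      decayRate n Λ := by
  have htr := trace_pos hd hΛ
  have hn' : (0 : ℝ) < n := by exact_mod_cast hn
  have hmin := lambdaMin_pos hd hΛ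
  refine norm_le_of_orthonormalBasis_eigenvectors hΛ.1.eigenvectorBasis _
    (μ := fun i => (hΛ.1.eigenvalues i + Λ.trace) / ((n + 1) * hΛ.1.eigenvalues i + Λ.trace))
    (fun i => ?_) (decayRate_pos n hd hΛ).le fun i => ?_
  · have hev := hΛ.eigenvalues_pos i
    rw [_root_.sub_apply, mul_apply_eq_comp,
      toEuclideanCLM_eigenvectorBasis, map_smul,
      toEuclideanCLM_gammaMat_inv_eigenvectorBasis hn hd hΛ, smul_smul,
      one_apply_eq_self]
    nth_rewrite 1 [← one_smul ℝ (hΛ.1.eigenvectorBasis i)]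
    rw [← sub_smul]
    congr 1
    field_simp
    ring
  · have hev := hΛ.eigenvalues_pos i
    have hle := lambdaMin_le hΛ.1 i
    rw [abs_of_nonneg (by positivity)]
    have h : decayRate n Λ =
        (lambdaMin Λ + Λ.trace) / ((n + 1) * lambdaMin Λ + Λ.trace) := by
      unfold decayRate hard
      field_simp
      ring
    rw [h, div_le_div_iff₀ (by positivity) (by positivity)]
    nlinarith [mul_le_mul_of_nonneg_left hle (mul_pos hn' htr).le]

end Spectral

/-! ### Gaussian exponential moments -/

theorem exp_neg_sub_le_one_sub {y : ℝ} (hy : |y| ≤ 1 / 2) :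
    Real.exp (-y - 2 * y ^ 2) ≤ 1 - y := by
  obtain ⟨h1, h2⟩ := abs_le.1 hy
  have h3 : 1 + (y + 2 * y ^ 2) ≤ Real.exp (y + 2 * y ^ 2) := by
    linarith [Real.add_one_le_exp (y + 2 * y ^ 2)]
  have h4 : 1 ≤ (1 - y) * Real.exp (y + 2 * y ^ 2) := by
    -- The product equals 1 + y²(1 - 2y).
    calc (1 : ℝ) ≤ (1 - y) * (1 + (y + 2 * y ^ 2)) := by nlinarith [sq_nonneg y]
      _ ≤ _ := by gcongr; linarith
  have h5 : -y - 2 * y ^ 2 = -(y + 2 * y ^ 2) := by ring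
  rw [h5, Real.exp_neg, inv_le_iff_one_le_mul₀ (Real.exp_pos _)]
  exact h4

theorem gaussianPDFReal_mul_exp_sq (s x : ℝ) :
    gaussianPDFReal 0 1 x * Real.exp (s * x ^ 2) =
      (√(2 * Real.pi))⁻¹ * Real.exp (-(1 / 2 - s) * x ^ 2) := by
  rw [gaussianPDFReal, mul_assoc, ← Real.exp_add]
  simp only [NNReal.coe_one, mul_one, sub_zero]
  congr 2
  ring

theorem integrable_exp_mul_sq_gaussianReal {s : ℝ} (hs : s < 1 / 2) :
    Integrable (fun x => Real.exp (s * x ^ 2)) (gaussianReal 0 1) := by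
  rw [gaussianReal_of_var_ne_zero _ one_ne_zero,
    integrable_withDensity_iff_integrable_smul₀' (by fun_prop)
      (Filter.Eventually.of_forall fun _ => gaussianPDF_lt_top)]
  simp only [toReal_gaussianPDF, smul_eq_mul, gaussianPDFReal_mul_exp_sq]
  exact (integrable_exp_neg_mul_sq (by linarith)).const_mul _

theorem integral_exp_mul_sq_gaussianReal {s : ℝ} (hs : s < 1 / 2) :
    ∫ x, Real.exp (s * x ^ 2) ∂gaussianReal 0 1 = (√(1 - 2 * s))⁻¹ := by
  rw [integral_gaussianReal_eq_integral_smul one_ne_zero]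
  simp only [smul_eq_mul, gaussianPDFReal_mul_exp_sq]
  rw [integral_const_mul, integral_gaussian, ← Real.sqrt_inv, ← Real.sqrt_inv,
    ← Real.sqrt_mul (by positivity)]
  congr 1
  have : (1 / 2 - s) ≠ 0 := by linarith
  have : (1 - 2 * s) ≠ 0 := by linarith
  field_simp

theorem integral_exp_mul_sq_sub_one_gaussianReal_le {s : ℝ} (hs : |s| ≤ 1 / 4) :
    ∫ x, Real.exp (s * (x ^ 2 - 1)) ∂gaussianReal 0 1 ≤ Real.exp (4 * s ^ 2) := by
  obtain ⟨h1, h2⟩ := abs_le.1 hs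
  simp only [mul_sub, mul_one, Real.exp_sub]
  rw [integral_div, integral_exp_mul_sq_gaussianReal (by linarith), div_le_iff₀ (Real.exp_pos _),
    ← Real.exp_add]
  have h := exp_neg_sub_le_one_sub (y := 2 * s) (by rw [abs_mul, abs_two]; linarith)
  have h3 : √(Real.exp (-(2 * s) - 2 * (2 * s) ^ 2)) ≤ √(1 - 2 * s) := Real.sqrt_le_sqrt h
  rw [← Real.exp_half] at h3
  calc (√(1 - 2 * s))⁻¹ ≤ (Real.exp ((-(2 * s) - 2 * (2 * s) ^ 2) / 2))⁻¹ := by gcongr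
    _ = _ := by rw [← Real.exp_neg]; congr 1; ring

section GaussianData

variable {d : ℕ} {Λ : Matrix (Fin d) (Fin d) ℝ}

theorem quadForm_nonneg (hΛ : Λ.PosDef) (v : EuclideanSpace ℝ (Fin d)) :
    0 ≤ inner ℝ v (toEuclideanCLM (𝕜 := ℝ) Λ v) := by
  have := hΛ.posSemidef.dotProduct_mulVec_nonneg v.ofLp
  simpa [PiLp.inner_apply, dotProduct, mul_comm] using this

theorem map_inner_multivariateGaussian (hΛ : Λ.PosDef) (v : EuclideanSpace ℝ (Fin d)) :
    (multivariateGaussian 0 Λ).map (fun x => inner ℝ x v) =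
      (gaussianReal 0 1).map (fun t => √(inner ℝ v (toEuclideanCLM (𝕜 := ℝ) Λ v)) * t) := by
  have hq0 := quadForm_nonneg hΛ v
  have hcoe : (fun x : EuclideanSpace ℝ (Fin d) => inner ℝ x v) = innerSL ℝ v := by
    ext x
    simp [real_inner_comm]
  have hvar : Var[innerSL ℝ v; multivariateGaussian 0 Λ] =
      inner ℝ v (toEuclideanCLM (𝕜 := ℝ) Λ v) := by
    rw [← covariance_self (by fun_prop), inner_toEuclideanCLM,
      ← covarianceBilin_multivariateGaussian (μ := 0) hΛ.posSemidef v v,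
      covarianceBilin_apply_eq_cov IsGaussian.memLp_two_id]
    rfl
  have hmean : ∫ x, innerSL ℝ v x ∂multivariateGaussian 0 Λ = 0 := by
    rw [(innerSL ℝ v).integral_comp_id_comm IsGaussian.integrable_id,
      integral_id_multivariateGaussian, map_zero]
  rw [gaussianReal_map_const_mul, hcoe, IsGaussian.map_eq_gaussianReal, hvar, hmean]
  congr 1
  · simp
  · ext
    simp [hq0]

theorem integrable_exp_inner_sq (hΛ : Λ.PosDef) (v : EuclideanSpace ℝ (Fin d)) {s : ℝ}
    (hs : |s| * inner ℝ v (toEuclideanCLM (𝕜 := ℝ) Λ v) ≤ 1 / 4) :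
    Integrable (fun x => Real.exp (s * (inner ℝ x v ^ 2 -
      inner ℝ v (toEuclideanCLM (𝕜 := ℝ) Λ v)))) (multivariateGaussian 0 Λ) := by
  set q := inner ℝ v (toEuclideanCLM (𝕜 := ℝ) Λ v) with hq
  have hq0 : 0 ≤ q := quadForm_nonneg hΛ v
  have hF : Continuous fun t : ℝ => Real.exp (s * (t ^ 2 - q)) := by fun_prop
  change Integrable ((fun t : ℝ => Real.exp (s * (t ^ 2 - q))) ∘ fun x => inner ℝ x v) _
  rw [← integrable_map_measure hF.aestronglyMeasurable (by fun_prop),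
    map_inner_multivariateGaussian hΛ v,
    integrable_map_measure hF.aestronglyMeasurable (by fun_prop)]
  have h1 : s * q < 1 / 2 := by nlinarith [le_abs_self s]
  convert (integrable_exp_mul_sq_gaussianReal h1).mul_const (Real.exp (-(s * q))) using 2 with t
  simp only [Function.comp, ← hq]
  rw [mul_pow, Real.sq_sqrt hq0, ← Real.exp_add]
  congr 1
  ring

theorem integral_exp_inner_sq_le (hΛ : Λ.PosDef) (v : EuclideanSpace ℝ (Fin d)) {s : ℝ}
    (hs : |s| * inner ℝ v (toEuclideanCLM (𝕜 := ℝ) Λ v) ≤ 1 / 4) :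
    ∫ x, Real.exp (s * (inner ℝ x v ^ 2 - inner ℝ v (toEuclideanCLM (𝕜 := ℝ) Λ v)))
      ∂multivariateGaussian 0 Λ ≤
      Real.exp (4 * (s * inner ℝ v (toEuclideanCLM (𝕜 := ℝ) Λ v)) ^ 2) := by
  set q := inner ℝ v (toEuclideanCLM (𝕜 := ℝ) Λ v) with hq
  have hq0 : 0 ≤ q := quadForm_nonneg hΛ v
  have hF : Continuous fun t : ℝ => Real.exp (s * (t ^ 2 - q)) := by fun_prop
  rw [← integral_map (φ := fun x => inner ℝ x v) (f := fun t : ℝ => Real.exp (s * (t ^ 2 - q)))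
    (by fun_prop) hF.aestronglyMeasurable, map_inner_multivariateGaussian hΛ v,
    integral_map (by fun_prop) hF.aestronglyMeasurable]
  refine le_trans (le_of_eq ?_) (integral_exp_mul_sq_sub_one_gaussianReal_le (s := s * q)
    (by rwa [abs_mul, abs_of_nonneg hq0]))
  congr 1 with t
  rw [← hq, mul_pow, Real.sq_sqrt hq0]
  congr 1
  ring

theorem inner_sampleCov_sub {m : ℕ} (hm : 1 ≤ m) (x : Fin m → EuclideanSpace ℝ (Fin d))
    (v : EuclideanSpace ℝ (Fin d)) :
    inner ℝ ((sampleCov x - toEuclideanCLM (𝕜 := ℝ) Λ) v) v = ∑ j, (m : ℝ)⁻¹ *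
      (inner ℝ (x j) v ^ 2 - inner ℝ v (toEuclideanCLM (𝕜 := ℝ) Λ v)) := by
  have hm' : (m : ℝ) ≠ 0 := by positivity
  rw [_root_.sub_apply, sampleCov_apply, inner_sub_left, real_inner_smul_left,
    sum_inner, ← Finset.mul_sum, Finset.sum_sub_distrib, mul_sub]
  simp [real_inner_smul_right, pow_two, hm', real_inner_comm v]

theorem exp_mul_inner_sampleCov_sub {m : ℕ} (hm : 1 ≤ m) (θ : ℝ)
    (x : Fin m → EuclideanSpace ℝ (Fin d)) (v : EuclideanSpace ℝ (Fin d)) :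
    Real.exp (θ * inner ℝ ((sampleCov x - toEuclideanCLM (𝕜 := ℝ) Λ) v) v) =
      ∏ j, Real.exp (θ / m *
        (inner ℝ (x j) v ^ 2 - inner ℝ v (toEuclideanCLM (𝕜 := ℝ) Λ v))) := by
  rw [inner_sampleCov_sub hm, ← Real.exp_sum, Finset.mul_sum]
  simp only [div_eq_mul_inv, mul_assoc]

/-- For fixed v the exponential factors over the independent samples, and each factor is the
transform of a centred, scaled χ² variable. The condition on θ keeps each factor within the range
|s| ≤ 1/4 of `integral_exp_mul_sq_sub_one_gaussianReal_le`. -/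
theorem lintegral_exp_mul_inner_sampleCov_sub_le {m : ℕ} (hm : 1 ≤ m) (hΛ : Λ.PosDef) {q θ : ℝ}
    (v : EuclideanSpace ℝ (Fin d))
    (hv : inner ℝ v (toEuclideanCLM (𝕜 := ℝ) Λ v) ≤ q) (hθ : |θ| * q ≤ m / 4) :
    ∫⁻ x, ENNReal.ofReal
        (Real.exp (θ * inner ℝ ((sampleCov x - toEuclideanCLM (𝕜 := ℝ) Λ) v) v))
      ∂(Measure.pi fun _ : Fin m => multivariateGaussian 0 Λ) ≤
      ENNReal.ofReal (Real.exp (4 * θ ^ 2 * q ^ 2 / m)) := by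
  have hm' : (0 : ℝ) < m := by exact_mod_cast hm
  have hq0 := quadForm_nonneg hΛ v
  have hs : |θ / m| * inner ℝ v (toEuclideanCLM (𝕜 := ℝ) Λ v) ≤ 1 / 4 := by
    rw [abs_div, abs_of_pos hm', div_mul_eq_mul_div, div_le_iff₀ hm']
    nlinarith [abs_nonneg θ]
  simp only [exp_mul_inner_sampleCov_sub hm]
  rw [← ofReal_integral_eq_lintegral_ofReal]
  · apply ENNReal.ofReal_le_ofReal
    rw [integral_fintype_prod_eq_pow (fun y : EuclideanSpace ℝ (Fin d) => Real.exp (θ / m *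
        (inner ℝ y v ^ 2 - inner ℝ v (toEuclideanCLM (𝕜 := ℝ) Λ v)))), Fintype.card_fin]
    calc _ ≤ Real.exp (4 * (θ / m * inner ℝ v (toEuclideanCLM (𝕜 := ℝ) Λ v)) ^ 2) ^ m := by
          gcongr
          exact integral_exp_inner_sq_le hΛ v hs
      _ ≤ _ := by
        rw [← Real.exp_nat_mul, mul_pow, div_pow]
        apply Real.exp_le_exp.2
        have : inner ℝ v (toEuclideanCLM (𝕜 := ℝ) Λ v) ^ 2 ≤ q ^ 2 := by gcongr
        calc _ = 4 * θ ^ 2 * inner ℝ v (toEuclideanCLM (𝕜 := ℝ) Λ v) ^ 2 / m := by field_simp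
          _ ≤ _ := by gcongr
  · exact Integrable.fintype_prod (f := fun _ y => Real.exp (θ / m *
        (inner ℝ y v ^ 2 - inner ℝ v (toEuclideanCLM (𝕜 := ℝ) Λ v))))
      fun _ => integrable_exp_inner_sq hΛ v hs
  · exact Filter.Eventually.of_forall fun _ => Finset.prod_nonneg fun _ _ => (Real.exp_pos _).le

theorem integrable_norm_sq_multivariateGaussian (d : ℕ) :
    Integrable (fun w : EuclideanSpace ℝ (Fin d) => ‖w‖ ^ 2)
      (multivariateGaussian 0 (1 : Matrix (Fin d) (Fin d) ℝ)) :=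
  (IsGaussian.memLp_two_id).integrable_norm_pow (by norm_num)

theorem integral_norm_sq_multivariateGaussian (d : ℕ) :
    ∫ w : EuclideanSpace ℝ (Fin d), ‖w‖ ^ 2
      ∂(multivariateGaussian 0 (1 : Matrix (Fin d) (Fin d) ℝ)) = d := by
  have hmp := fun i : Fin d => measurePreserving_eval_multivariateGaussian
    (μ := (0 : EuclideanSpace ℝ (Fin d))) (Matrix.PosSemidef.one (n := Fin d) (R := ℝ)) (i := i)
  have hm2 : MemLp (id : ℝ → ℝ) 2 (gaussianReal 0 1) := memLp_id_gaussianReal 2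
  have hint : ∫ t, t ^ 2 ∂gaussianReal 0 1 = 1 := by
    have h := variance_id_gaussianReal (μ := 0) (v := 1)
    rw [variance_eq_sub hm2] at h
    simpa using h
  have hmap : ∀ i : Fin d, (multivariateGaussian 0 (1 : Matrix (Fin d) (Fin d) ℝ)).map
      (fun x => x i) = gaussianReal 0 1 := fun i => by simpa using (hmp i).map_eq
  simp only [EuclideanSpace.real_norm_sq_eq]
  rw [integral_finsetSum]
  · have : ∀ i : Fin d, ∫ w : EuclideanSpace ℝ (Fin d), w i ^ 2
        ∂(multivariateGaussian 0 (1 : Matrix (Fin d) (Fin d) ℝ)) = 1 := fun i => by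
      rw [← hint, ← hmap i, integral_map (by fun_prop) (by fun_prop)]
    simp only [this]
    simp
  · intro i _
    have : Integrable (fun t : ℝ => t ^ 2)
        ((multivariateGaussian 0 (1 : Matrix (Fin d) (Fin d) ℝ)).map (fun x => x i)) := by
      rw [hmap i]
      exact hm2.integrable_sq
    exact (integrable_map_measure (by fun_prop) (by fun_prop)).1 this

end GaussianData

/-! ### Operator norm versus averages of the quadratic form -/

section OperatorNorm

variable {E : Type*} [NormedAddCommGroup E] [InnerProductSpace ℝ E]

theorem exists_norm_le_one_le_abs_inner {T : E →L[ℝ] E} (hT : (T : E →ₗ[ℝ] E).IsSymmetric) :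
    ∃ u : E, ‖u‖ ≤ 1 ∧ 3 / 4 * ‖T‖ ≤ |inner ℝ (T u) u| := by
  rcases eq_or_ne T 0 with rfl | h0
  · exact ⟨0, by simp, by simp⟩
  have hlt : 3 / 4 * ‖T‖ < ⨆ x, |T.rayleighQuotient x| := by
    rw [← T.norm_eq_iSup_rayleighQuotient hT]
    linarith [norm_pos_iff.2 h0]
  obtain ⟨x, hx⟩ := exists_lt_of_lt_ciSup hlt
  have hx0 : x ≠ 0 := by
    rintro rfl
    rw [ContinuousLinearMap.rayleighQuotient_apply_zero, abs_zero] at hx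
    linarith [norm_nonneg T]
  refine ⟨‖x‖⁻¹ • x, by simp [norm_smul, hx0], hx.le.trans (le_of_eq ?_)⟩
  rw [map_smul, real_inner_smul_left, real_inner_smul_right, ContinuousLinearMap.rayleighQuotient,
    ContinuousLinearMap.reApplyInnerSelf_apply]
  congr 1
  simp only [RCLike.re_to_real]
  field_simp

variable [MeasurableSpace E] [BorelSpace E] [FiniteDimensional ℝ E]

/-- A continuous substitute for an ε-net. By the parallelogram identity the values of the form at u
+ h and u - h sum to at least 2·(3/4)‖T‖ - 2·(1/4)‖T‖ = ‖T‖ for ‖h‖ < 1/2, so one of them is at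
least ‖T‖/2. Integrating over h keeps both points in the ball of radius 3/2. -/
theorem ofReal_exp_norm_mul_measure_ball_le_of_inner (μ : Measure E) [μ.IsAddHaarMeasure]
    {T : E →L[ℝ] E} {u : E} (hu : ‖u‖ ≤ 1)
    (hTu : 3 / 4 * ‖T‖ ≤ inner ℝ (T u) u) {θ : ℝ} (hθ : 0 ≤ θ) :
    ENNReal.ofReal (Real.exp (θ / 2 * ‖T‖)) * μ (Metric.ball 0 (1 / 2)) ≤
      2 * ∫⁻ v in Metric.ball 0 (3 / 2), ENNReal.ofReal (Real.exp (θ * inner ℝ (T v) v)) ∂μ := by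
  set F : E → ENNReal := fun v => ENNReal.ofReal (Real.exp (θ * inner ℝ (T v) v)) with hF
  have hFm : Measurable F := by fun_prop
  have hpt : ∀ h ∈ Metric.ball (0 : E) (1 / 2),
      ENNReal.ofReal (Real.exp (θ / 2 * ‖T‖)) ≤ F (u + h) + F (u - h) := by
    intro h hh
    rw [mem_ball_zero_iff] at hh
    rw [hF, ← ENNReal.ofReal_add (Real.exp_pos _).le (Real.exp_pos _).le]
    apply ENNReal.ofReal_le_ofReal
    have hq : |inner ℝ (T h) h| ≤ ‖T‖ / 4 := by
      calc |inner ℝ (T h) h| ≤ ‖T h‖ * ‖h‖ := abs_real_inner_le_norm _ _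
        _ ≤ ‖T‖ * ‖h‖ * ‖h‖ := by gcongr; exact T.le_opNorm h
        _ ≤ ‖T‖ * (1 / 2) * (1 / 2) := by gcongr
        _ = ‖T‖ / 4 := by ring
    have hsum : inner ℝ (T (u + h)) (u + h) + inner ℝ (T (u - h)) (u - h) =
        2 * inner ℝ (T u) u + 2 * inner ℝ (T h) h := by
      simp only [map_add, map_sub, inner_add_left, inner_add_right, inner_sub_left,
        inner_sub_right]
      ring
    have hge : ‖T‖ ≤ inner ℝ (T (u + h)) (u + h) + inner ℝ (T (u - h)) (u - h) := by
      linarith [(abs_le.1 hq).1]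
    rcases le_total (‖T‖ / 2) (inner ℝ (T (u + h)) (u + h)) with h1 | h1
    · have : Real.exp (θ / 2 * ‖T‖) ≤ Real.exp (θ * inner ℝ (T (u + h)) (u + h)) :=
        Real.exp_le_exp.2 (by nlinarith)
      linarith [Real.exp_pos (θ * inner ℝ (T (u - h)) (u - h))]
    · have : Real.exp (θ / 2 * ‖T‖) ≤ Real.exp (θ * inner ℝ (T (u - h)) (u - h)) :=
        Real.exp_le_exp.2 (by nlinarith)
      linarith [Real.exp_pos (θ * inner ℝ (T (u + h)) (u + h))]
  set I := ∫⁻ v in Metric.ball 0 (3 / 2), F v ∂μ with hI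
  have hind : ∀ z : E, ‖z‖ < 1 / 2 → u + z ∈ Metric.ball (0 : E) (3 / 2) := fun z hz => by
    rw [mem_ball_zero_iff]
    linarith [norm_add_le u z]
  have hadd : ∫⁻ h in Metric.ball 0 (1 / 2), F (u + h) ∂μ ≤ I := by
    rw [hI, ← lintegral_indicator measurableSet_ball, ← lintegral_indicator measurableSet_ball,
      ← lintegral_add_left_eq_self ((Metric.ball 0 (3 / 2)).indicator F) u]
    refine lintegral_mono fun h => ?_
    by_cases hh : h ∈ Metric.ball (0 : E) (1 / 2)
    · rw [Set.indicator_of_mem hh, Set.indicator_of_mem (hind h (mem_ball_zero_iff.1 hh))]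
    · rw [Set.indicator_of_notMem hh]
      exact zero_le
  have hsub : ∫⁻ h in Metric.ball 0 (1 / 2), F (u - h) ∂μ ≤ I := by
    rw [hI, ← lintegral_indicator measurableSet_ball, ← lintegral_indicator measurableSet_ball,
      ← lintegral_sub_left_eq_self ((Metric.ball 0 (3 / 2)).indicator F) u]
    refine lintegral_mono fun h => ?_
    by_cases hh : h ∈ Metric.ball (0 : E) (1 / 2)
    · have := hind (-h) (by rw [norm_neg]; exact mem_ball_zero_iff.1 hh)
      rw [← sub_eq_add_neg] at this
      rw [Set.indicator_of_mem hh, Set.indicator_of_mem this]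
    · rw [Set.indicator_of_notMem hh]
      exact zero_le
  calc ENNReal.ofReal (Real.exp (θ / 2 * ‖T‖)) * μ (Metric.ball 0 (1 / 2))
      = ∫⁻ _ in Metric.ball (0 : E) (1 / 2), ENNReal.ofReal (Real.exp (θ / 2 * ‖T‖)) ∂μ := by
        rw [setLIntegral_const]
    _ ≤ ∫⁻ h in Metric.ball 0 (1 / 2), (F (u + h) + F (u - h)) ∂μ :=
        setLIntegral_mono (by fun_prop) hpt
    _ = ∫⁻ h in Metric.ball 0 (1 / 2), F (u + h) ∂μ +
          ∫⁻ h in Metric.ball 0 (1 / 2), F (u - h) ∂μ := lintegral_add_left (by fun_prop) _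
    _ ≤ I + I := add_le_add hadd hsub
    _ = 2 * I := (two_mul I).symm

/-- The exponential of the norm of a symmetric operator is dominated by an average, over a ball,
of exponentials of its quadratic form. -/
theorem ofReal_exp_norm_mul_measure_ball_le (μ : Measure E) [μ.IsAddHaarMeasure]
    {T : E →L[ℝ] E} (hT : (T : E →ₗ[ℝ] E).IsSymmetric) {θ : ℝ} (hθ : 0 ≤ θ) :
    ENNReal.ofReal (Real.exp (θ / 2 * ‖T‖)) * μ (Metric.ball 0 (1 / 2)) ≤
      2 * ∫⁻ v in Metric.ball 0 (3 / 2), (ENNReal.ofReal (Real.exp (θ * inner ℝ (T v) v)) +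
        ENNReal.ofReal (Real.exp (-θ * inner ℝ (T v) v))) ∂μ := by
  obtain ⟨u, hu, hTu⟩ := exists_norm_le_one_le_abs_inner hT
  -- The form may be negative at u; then -T is used, which is why both signs of θ occur in the
  -- average.
  rcases le_abs'.1 hTu with h | h
  · have h' : 3 / 4 * ‖-T‖ ≤ inner ℝ ((-T) u) u := by
      rw [norm_neg, _root_.neg_apply, inner_neg_left]
      linarith
    have := ofReal_exp_norm_mul_measure_ball_le_of_inner μ hu h' hθ
    rw [norm_neg] at this
    refine this.trans ?_
    gcongr with v
    simp
  · refine (ofReal_exp_norm_mul_measure_ball_le_of_inner μ hu h hθ).trans ?_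
    gcongr with v
    exact le_self_add

end OperatorNorm

/-! ### Exponential moment of the covariance deviation -/

section Concentration

variable {d m : ℕ} {Λ : Matrix (Fin d) (Fin d) ℝ}

theorem lintegral_setLIntegral_le {X V : Type*} [MeasurableSpace X] [MeasurableSpace V]
    {P : Measure X} {μ : Measure V} [SFinite P] [SFinite μ] {H : X → V → ENNReal}
    (hH : Measurable (Function.uncurry H)) {s : Set V} (hs : MeasurableSet s) {K : ENNReal}
    (hK : ∀ v ∈ s, ∫⁻ x, H x v ∂P ≤ K) :
    ∫⁻ x, (∫⁻ v in s, H x v ∂μ) ∂P ≤ K * μ s := by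
  rw [lintegral_lintegral_swap hH.aemeasurable]
  exact (setLIntegral_mono' hs hK).trans (by rw [setLIntegral_const])

theorem continuous_sampleCov :
    Continuous (sampleCov : (Fin m → EuclideanSpace ℝ (Fin d)) → _) := by
  unfold sampleCov
  have : ∀ j : Fin m, Continuous fun x : Fin m → EuclideanSpace ℝ (Fin d) =>
      (innerSL ℝ (x j)).smulRight (x j) := fun j => by
    have h : Continuous fun y : EuclideanSpace ℝ (Fin d) => (innerSL ℝ y).smulRight y :=
      ((ContinuousLinearMap.smulRightL ℝ (EuclideanSpace ℝ (Fin d)) (EuclideanSpace ℝ (Fin d))).comp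
        (innerSL ℝ)).continuous.clm_apply continuous_id
    exact h.comp (continuous_apply j)
  fun_prop

theorem isSymmetric_sampleCov_sub (hΛ : Λ.PosDef) (x : Fin m → EuclideanSpace ℝ (Fin d)) :
    ((sampleCov x - toEuclideanCLM (𝕜 := ℝ) Λ : EuclideanSpace ℝ (Fin d) →L[ℝ] _) :
      EuclideanSpace ℝ (Fin d) →ₗ[ℝ] EuclideanSpace ℝ (Fin d)).IsSymmetric := by
  have hL : IsSelfAdjoint (toEuclideanCLM (𝕜 := ℝ) Λ) :=
    IsSelfAdjoint.map hΛ.1.isSelfAdjoint _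
  have hL' := (ContinuousLinearMap.isSelfAdjoint_iff_isSymmetric.1 hL)
  have hS : ((sampleCov x : EuclideanSpace ℝ (Fin d) →L[ℝ] _) :
      EuclideanSpace ℝ (Fin d) →ₗ[ℝ] EuclideanSpace ℝ (Fin d)).IsSymmetric := by
    intro v w
    simp only [ContinuousLinearMap.coe_coe, sampleCov_apply, real_inner_smul_left,
      real_inner_smul_right, sum_inner, inner_sum]
    congr 1
    refine Finset.sum_congr rfl fun j _ => ?_
    rw [real_inner_comm (x j) v]
    ring
  exact hS.sub hL'

theorem inner_toEuclideanCLM_le (hΛ : Λ.PosDef) {b : ℝ} (hb : 0 ≤ b)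
    (hΛb : ∀ i, hΛ.1.eigenvalues i ≤ b) (v : EuclideanSpace ℝ (Fin d)) :
    inner ℝ v (toEuclideanCLM (𝕜 := ℝ) Λ v) ≤ b * ‖v‖ ^ 2 := by
  have hn : ‖toEuclideanCLM (𝕜 := ℝ) Λ‖ ≤ b :=
    norm_le_of_orthonormalBasis_eigenvectors hΛ.1.eigenvectorBasis _
      (toEuclideanCLM_eigenvectorBasis hΛ.1) hb fun i => by
        rw [abs_of_pos (hΛ.eigenvalues_pos i)]
        exact hΛb i
  calc inner ℝ v (toEuclideanCLM (𝕜 := ℝ) Λ v) ≤ ‖v‖ * ‖toEuclideanCLM (𝕜 := ℝ) Λ v‖ :=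
        real_inner_le_norm _ _
    _ ≤ ‖v‖ * (b * ‖v‖) := by
        gcongr
        exact ContinuousLinearMap.le_of_opNorm_le _ hn v
    _ = _ := by ring

/-- Tonelli moves the expectation inside the ball average, where ⟨v, Λv⟩ ≤ 9b/4. The factor 3^d is
the volume ratio of the balls of radii 3/2 and 1/2, the 4 collects the two signs and the factor 2 of
the averaging bound, and 81/4 = 4·(9/4)². -/
theorem lintegral_exp_norm_sampleCov_sub_le (hm : 1 ≤ m) (hΛ : Λ.PosDef) {b θ : ℝ} (hb : 0 ≤ b)
    (hΛb : ∀ i, hΛ.1.eigenvalues i ≤ b) (hθ : 0 ≤ θ) (hθm : θ * (9 * b) ≤ m) :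
    ∫⁻ x, ENNReal.ofReal (Real.exp (θ / 2 * ‖sampleCov x - toEuclideanCLM (𝕜 := ℝ) Λ‖))
      ∂(Measure.pi fun _ : Fin m => multivariateGaussian 0 Λ) ≤
      ENNReal.ofReal (4 * 3 ^ d * Real.exp (81 / 4 * θ ^ 2 * b ^ 2 / m)) := by
  set P : Measure (Fin m → EuclideanSpace ℝ (Fin d)) :=
    Measure.pi fun _ : Fin m => multivariateGaussian 0 Λ with hP
  set K : ENNReal := ENNReal.ofReal (Real.exp (81 / 4 * θ ^ 2 * b ^ 2 / m)) with hK
  set B := (volume : Measure (EuclideanSpace ℝ (Fin d))) (Metric.ball 0 (1 / 2)) with hB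
  have hB0 : B ≠ 0 := (Metric.measure_ball_pos _ _ (by norm_num)).ne'
  have hBtop : B ≠ ⊤ := measure_ball_lt_top.ne
  have hvol : (volume : Measure (EuclideanSpace ℝ (Fin d))) (Metric.ball 0 (3 / 2)) =
      3 ^ d * B := by
    have h := Measure.addHaar_ball_mul_of_pos
      (volume : Measure (EuclideanSpace ℝ (Fin d))) 0 (r := 3) (by norm_num) (1 / 2)
    rw [show (3 : ℝ) * (1 / 2) = 3 / 2 by norm_num, finrank_euclideanSpace_fin] at h
    rw [h, hB, ENNReal.ofReal_pow (by norm_num)]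
    norm_num
  obtain ⟨F, hF⟩ : ∃ F : ℝ → (Fin m → EuclideanSpace ℝ (Fin d)) → EuclideanSpace ℝ (Fin d) →
      ENNReal, ∀ s x v, F s x v = ENNReal.ofReal (Real.exp
        (s * inner ℝ ((sampleCov x - toEuclideanCLM (𝕜 := ℝ) Λ) v) v)) :=
    ⟨_, fun _ _ _ => rfl⟩
  have hmeas : ∀ s : ℝ, Measurable (Function.uncurry (F s)) := fun s => by
    have : Continuous fun p : (Fin m → EuclideanSpace ℝ (Fin d)) × EuclideanSpace ℝ (Fin d) =>
        s * inner ℝ ((sampleCov p.1 - toEuclideanCLM (𝕜 := ℝ) Λ) p.2) p.2 := by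
      simp only [_root_.sub_apply, sampleCov_apply]
      fun_prop
    simp only [Function.uncurry_def, hF]
    exact (Real.measurable_exp.comp this.measurable).ennreal_ofReal
  have hquad : ∀ s : ℝ, |s| = θ → ∀ v ∈ Metric.ball (0 : EuclideanSpace ℝ (Fin d)) (3 / 2),
      ∫⁻ x, F s x v ∂P ≤ K := by
    intro s hs v hv
    rw [mem_ball_zero_iff] at hv
    have hq : inner ℝ v (toEuclideanCLM (𝕜 := ℝ) Λ v) ≤ 9 / 4 * b := by
      refine (inner_toEuclideanCLM_le hΛ hb hΛb v).trans ?_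
      have : ‖v‖ ^ 2 ≤ (3 / 2) ^ 2 := by gcongr
      nlinarith
    simp only [hF]
    refine (lintegral_exp_mul_inner_sampleCov_sub_le hm hΛ (θ := s) v hq
      (by rw [hs]; linarith)).trans (le_of_eq ?_)
    rw [hK, ← sq_abs s, hs]
    congr 3
    ring
  have hball : ∀ x, ENNReal.ofReal
      (Real.exp (θ / 2 * ‖sampleCov x - toEuclideanCLM (𝕜 := ℝ) Λ‖)) * B ≤
      2 * ∫⁻ v in Metric.ball 0 (3 / 2), (F θ x v + F (-θ) x v) := fun x => by
    simp only [hF]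
    exact ofReal_exp_norm_mul_measure_ball_le volume (isSymmetric_sampleCov_sub hΛ x) hθ
  have hsum : ∀ v ∈ Metric.ball (0 : EuclideanSpace ℝ (Fin d)) (3 / 2),
      ∫⁻ x, (F θ x v + F (-θ) x v) ∂P ≤ K + K := fun v hv => by
    have hmv : Measurable fun x => F θ x v :=
      (hmeas θ).comp (measurable_id.prodMk measurable_const)
    rw [lintegral_add_left hmv]
    exact add_le_add (hquad θ (abs_of_nonneg hθ) v hv)
      (hquad (-θ) (by rw [abs_neg, abs_of_nonneg hθ]) v hv)
  have hmain : (∫⁻ x, ENNReal.ofReal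
      (Real.exp (θ / 2 * ‖sampleCov x - toEuclideanCLM (𝕜 := ℝ) Λ‖)) ∂P) * B ≤
      (4 * 3 ^ d * K) * B := by
    calc _ = ∫⁻ x, ENNReal.ofReal
          (Real.exp (θ / 2 * ‖sampleCov x - toEuclideanCLM (𝕜 := ℝ) Λ‖)) * B ∂P := by
          rw [lintegral_mul_const' _ _ hBtop]
      _ ≤ ∫⁻ x, 2 * (∫⁻ v in Metric.ball 0 (3 / 2), (F θ x v + F (-θ) x v)) ∂P :=
          lintegral_mono hball
      _ = 2 * ∫⁻ x, (∫⁻ v in Metric.ball 0 (3 / 2), (F θ x v + F (-θ) x v)) ∂P :=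
          lintegral_const_mul' _ _ (by norm_num)
      _ ≤ 2 * ((K + K) * volume (Metric.ball (0 : EuclideanSpace ℝ (Fin d)) (3 / 2))) :=
          mul_le_mul_right (lintegral_setLIntegral_le (H := fun x v => F θ x v + F (-θ) x v)
            ((hmeas θ).add (hmeas (-θ))) measurableSet_ball hsum) 2
      _ = (4 * 3 ^ d * K) * B := by
          rw [hvol]
          ring
  have := (ENNReal.mul_le_mul_iff_left hB0 hBtop).1 hmain
  refine this.trans (le_of_eq ?_)
  rw [ENNReal.ofReal_mul (by positivity), ENNReal.ofReal_mul (by positivity),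
    ENNReal.ofReal_pow (by norm_num)]
  norm_num [hK]

end Concentration

/-! ### Moments of growing order -/

theorem four_mul_three_pow_le_exp {d : ℕ} (hd : 1 ≤ d) : (4 : ℝ) * 3 ^ d ≤ Real.exp (3 * d) := by
  have h12 : (4 * 3 : ℝ) ≤ Real.exp 3 := by
    have h : (2.7 : ℝ) ^ 3 ≤ Real.exp 1 ^ 3 := by
      gcongr
      linarith [Real.exp_one_gt_d9]
    have h3 : Real.exp 3 = Real.exp 1 ^ 3 := by rw [← Real.exp_nat_mul]; norm_num
    rw [h3]
    linarith
  calc (4 : ℝ) * 3 ^ d ≤ 4 ^ d * 3 ^ d := by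
        gcongr
        exact le_self_pow₀ (by norm_num) (by omega)
    _ = (4 * 3) ^ d := (mul_pow _ _ _).symm
    _ ≤ Real.exp 3 ^ d := by gcongr
    _ = Real.exp (3 * d) := by rw [← Real.exp_nat_mul, mul_comm]

variable {d m : ℕ} {Λ : Matrix (Fin d) (Fin d) ℝ}

theorem exp_mul_le_convex {p : ℝ} (hp0 : 0 ≤ p) (hp1 : p ≤ 1) (u : ℝ) :
    Real.exp (p * u) ≤ p * Real.exp u + (1 - p) := by
  have := convexOn_exp.2 (Set.mem_univ u) (Set.mem_univ 0) hp0 (sub_nonneg.2 hp1) (by ring)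
  simpa using this

/-- At θ = ηtm with t = √(d/m), both the volume factor and the Gaussian factor are exp(O(d)), giving
exp(Kd) for the exponent θ/2. For s = p·θ/2 with p ≤ 1, convexity improves this to exp(pKd), and t²m
= d makes pd = 2st/η. -/
theorem integrable_exp_norm_sampleCov_sub_and_integral_le (hd : 1 ≤ d) (hm : 1 ≤ m)
    (hΛ : Λ.PosDef) {b η s : ℝ} (hb : 0 ≤ b) (hΛb : ∀ i, hΛ.1.eigenvalues i ≤ b) (hη : 0 < η)
    (hηt : 9 * b * η * √((d : ℝ) / m) ≤ 1) (hs0 : 0 ≤ s) (hs : s ≤ η * √((d : ℝ) / m) * m / 2) :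
    Integrable (fun x => Real.exp (s * ‖sampleCov x - toEuclideanCLM (𝕜 := ℝ) Λ‖))
      (Measure.pi fun _ : Fin m => multivariateGaussian 0 Λ) ∧
    ∫ x, Real.exp (s * ‖sampleCov x - toEuclideanCLM (𝕜 := ℝ) Λ‖)
      ∂(Measure.pi fun _ : Fin m => multivariateGaussian 0 Λ) ≤
      Real.exp (2 * (3 + 21 * η ^ 2 * b ^ 2) / η * (s * √((d : ℝ) / m))) := by
  set t := √((d : ℝ) / m) with ht
  set P : Measure (Fin m → EuclideanSpace ℝ (Fin d)) :=
    Measure.pi fun _ : Fin m => multivariateGaussian 0 Λ with hP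
  set K := 3 + 21 * η ^ 2 * b ^ 2 with hK
  set θ := η * t * m with hθ
  have hm' : (0 : ℝ) < m := by exact_mod_cast hm
  have hd' : (0 : ℝ) < d := by exact_mod_cast hd
  have ht0 : 0 < t := Real.sqrt_pos.2 (by positivity)
  have ht2 : t ^ 2 * m = d := by
    rw [ht, Real.sq_sqrt (by positivity)]
    field_simp
  have hθ0 : 0 < θ := by positivity
  have hcont : ∀ r : ℝ, Continuous fun x : Fin m → EuclideanSpace ℝ (Fin d) =>
      Real.exp (r * ‖sampleCov x - toEuclideanCLM (𝕜 := ℝ) Λ‖) := fun r => by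
    have := continuous_sampleCov (d := d) (m := m)
    fun_prop
  have hlint := lintegral_exp_norm_sampleCov_sub_le hm hΛ hb hΛb hθ0.le (by
    calc θ * (9 * b) = (9 * b * η * t) * m := by rw [hθ]; ring
      _ ≤ 1 * m := by gcongr
      _ = m := one_mul _)
  have hexp : 4 * 3 ^ d * Real.exp (81 / 4 * θ ^ 2 * b ^ 2 / m) ≤ Real.exp (K * d) := by
    calc _ ≤ Real.exp (3 * d) * Real.exp (21 * η ^ 2 * b ^ 2 * d) := by
          gcongr
          · exact four_mul_three_pow_le_exp hd
          · rw [hθ, div_le_iff₀ hm', ← ht2]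
            have : 0 ≤ (η * t * m) ^ 2 * b ^ 2 := by positivity
            nlinarith
      _ = _ := by rw [← Real.exp_add]; congr 1; rw [hK]; ring
  have hint : Integrable (fun x => Real.exp
      (θ / 2 * ‖sampleCov x - toEuclideanCLM (𝕜 := ℝ) Λ‖)) P := by
    refine ⟨(hcont _).aestronglyMeasurable, ?_⟩
    rw [hasFiniteIntegral_iff_ofReal (Filter.Eventually.of_forall fun _ => (Real.exp_pos _).le)]
    exact hlint.trans_lt ENNReal.ofReal_lt_top
  have hle : ∫ x, Real.exp (θ / 2 * ‖sampleCov x - toEuclideanCLM (𝕜 := ℝ) Λ‖) ∂P ≤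
      Real.exp (K * d) := by
    rw [integral_eq_lintegral_of_nonneg_ae
      (Filter.Eventually.of_forall fun _ => (Real.exp_pos _).le) (hcont _).aestronglyMeasurable]
    refine ENNReal.toReal_le_of_le_ofReal (Real.exp_pos _).le (hlint.trans ?_)
    exact ENNReal.ofReal_le_ofReal hexp
  set p := s / (θ / 2) with hp
  have hp0 : 0 ≤ p := by positivity
  have hp1 : p ≤ 1 := (div_le_one (by positivity)).2 hs
  -- Convexity is applied after shifting the exponent by -Kd, so that the bracket has expectation at
  -- most 1.
  have hpt : ∀ x : Fin m → EuclideanSpace ℝ (Fin d), Real.exp (s * ‖sampleCov x - toEuclideanCLM (𝕜 := ℝ) Λ‖) ≤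
      Real.exp (p * (K * d)) * (p * (Real.exp (-(K * d)) *
        Real.exp (θ / 2 * ‖sampleCov x - toEuclideanCLM (𝕜 := ℝ) Λ‖)) + (1 - p)) := fun x => by
    have h := exp_mul_le_convex hp0 hp1
      (-(K * d) + θ / 2 * ‖sampleCov x - toEuclideanCLM (𝕜 := ℝ) Λ‖)
    rw [Real.exp_add] at h
    refine le_trans (le_of_eq ?_) (mul_le_mul_of_nonneg_left h (Real.exp_pos _).le)
    rw [← Real.exp_add]
    congr 1
    rw [hp]
    field_simp
    ring
  have hint2 : Integrable (fun x => Real.exp (p * (K * d)) * (p * (Real.exp (-(K * d)) *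
      Real.exp (θ / 2 * ‖sampleCov x - toEuclideanCLM (𝕜 := ℝ) Λ‖)) + (1 - p))) P :=
    ((((hint.const_mul _).const_mul _).add (integrable_const _)).const_mul _)
  have hints : Integrable (fun x =>
      Real.exp (s * ‖sampleCov x - toEuclideanCLM (𝕜 := ℝ) Λ‖)) P :=
    hint2.mono' (hcont s).aestronglyMeasurable (Filter.Eventually.of_forall fun x => by
      rw [Real.norm_of_nonneg (Real.exp_pos _).le]
      exact hpt x)
  refine ⟨hints, ?_⟩
  calc _ ≤ ∫ x, Real.exp (p * (K * d)) * (p * (Real.exp (-(K * d)) *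
        Real.exp (θ / 2 * ‖sampleCov x - toEuclideanCLM (𝕜 := ℝ) Λ‖)) + (1 - p)) ∂P :=
        integral_mono hints hint2 hpt
    _ = Real.exp (p * (K * d)) * (p * (Real.exp (-(K * d)) *
        ∫ x, Real.exp (θ / 2 * ‖sampleCov x - toEuclideanCLM (𝕜 := ℝ) Λ‖) ∂P) + (1 - p)) := by
        rw [integral_const_mul, integral_add ((hint.const_mul _).const_mul _)
          (integrable_const _), integral_const_mul, integral_const_mul]
        simp
    _ ≤ Real.exp (p * (K * d)) * (p * (Real.exp (-(K * d)) * Real.exp (K * d)) + (1 - p)) := by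
        gcongr
    _ = Real.exp (p * (K * d)) := by
        rw [← Real.exp_add]
        simp
    _ = _ := by
        congr 1
        rw [hp, hθ, ← ht2]
        field_simp

theorem one_add_mul_pow_le {β τ X : ℝ} (hβ : 0 < β) (hτ : 0 < τ) (hX : 0 ≤ X) {j N : ℕ}
    (hjN : j ≤ N) :
    (1 + β * X) ^ j ≤ (N.factorial * (β / τ) ^ N * Real.exp (τ / β)) * Real.exp (τ * X) := by
  have h1 : 1 ≤ 1 + β * X := by linarith [mul_nonneg hβ.le hX]
  have h2 := Real.pow_div_factorial_le_exp (τ / β * (1 + β * X)) (by positivity) N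
  rw [div_le_iff₀ (by positivity)] at h2
  calc (1 + β * X) ^ j ≤ (1 + β * X) ^ N := pow_le_pow_right₀ h1 hjN
    _ = (β / τ) ^ N * (τ / β * (1 + β * X)) ^ N := by
        rw [← mul_pow]
        congr 1
        field_simp
    _ ≤ (β / τ) ^ N * (Real.exp (τ / β * (1 + β * X)) * N.factorial) := by gcongr
    _ = _ := by
        have : τ / β * (1 + β * X) = τ / β + τ * X := by field_simp
        rw [this, Real.exp_add]
        ring

theorem exp_le_one_add_mul_exp (y : ℝ) : Real.exp y ≤ 1 + y * Real.exp y := by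
  have h := Real.add_one_le_exp (-y)
  have h2 : Real.exp (-y) * Real.exp y = 1 := by rw [← Real.exp_add]; simp
  nlinarith [Real.exp_pos y]

/-- Moments of order `2k` of `1 + β ‖Ĉ - Λ‖`, with `Ĉ` the sample covariance, are
`1 + O(k √(d/m))` as long as `k² d = O(m)`. -/
theorem exists_integral_one_add_norm_pow_le {b β κ : ℝ} (hb : 0 < b) (hβ : 0 < β) (hκ : 0 < κ) :
    ∃ C : ℝ, 0 < C ∧ ∀ (d m k : ℕ) (Λ : Matrix (Fin d) (Fin d) ℝ) (hΛ : Λ.PosDef),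
      1 ≤ d → 1 ≤ k → κ * ((k : ℝ) ^ 2 * d) ≤ m → (∀ i, hΛ.1.eigenvalues i ≤ b) →
      Integrable (fun x => (1 + β * ‖sampleCov x - toEuclideanCLM (𝕜 := ℝ) Λ‖) ^ (2 * k))
        (Measure.pi fun _ : Fin m => multivariateGaussian 0 Λ) ∧
      ∫ x, (1 + β * ‖sampleCov x - toEuclideanCLM (𝕜 := ℝ) Λ‖) ^ (2 * k)
        ∂(Measure.pi fun _ : Fin m => multivariateGaussian 0 Λ) ≤
        1 + C * (k * √((d : ℝ) / m)) := by
  set r := √κ with hr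
  have hr0 : 0 < r := Real.sqrt_pos.2 hκ
  -- η makes s = 2kβ admissible, since rk ≤ tm. η' makes 9bη't ≤ 1 automatic, since t ≤ 1/r, and τ
  -- is then admissible because tm ≥ r. N bounds 2k when 9bηt > 1, because rkt ≤ 1.
  set η := 4 * β / r with hη
  have hη0 : 0 < η := by positivity
  set A := 2 * β * (2 * (3 + 21 * η ^ 2 * b ^ 2) / η) with hA
  set η' := r / (9 * b) with hη'
  have hη'0 : 0 < η' := by positivity
  set τ := η' * r / 2 with hτ
  have hτ0 : 0 < τ := by positivity
  set N := ⌈18 * b * η / r⌉₊ with hN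
  set c := N.factorial * (β / τ) ^ N * Real.exp (τ / β) with hc
  set D := c * Real.exp (2 * (3 + 21 * η' ^ 2 * b ^ 2) / η' * (τ * (1 / r))) with hD
  have hc0 : 0 < c := by positivity
  have hD0 : 0 < D := by positivity
  refine ⟨A * Real.exp (A * (1 / r)) + D * (9 * b * η), by positivity, ?_⟩
  intro d m k Λ hΛ hd hk hmk hΛb
  have hd' : (1 : ℝ) ≤ d := by exact_mod_cast hd
  have hk' : (1 : ℝ) ≤ k := by exact_mod_cast hk
  have hm' : (0 : ℝ) < m := lt_of_lt_of_le (by positivity) hmk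
  have hm : 1 ≤ m := by exact_mod_cast hm'
  set t := √((d : ℝ) / m) with ht
  have ht0 : 0 < t := Real.sqrt_pos.2 (by positivity)
  have ht2 : t ^ 2 * m = d := by
    rw [ht, Real.sq_sqrt (by positivity)]
    field_simp
  have hr2 : r ^ 2 = κ := Real.sq_sqrt hκ.le
  have hrkt : r * (k * t) ≤ 1 := by
    refine le_of_sq_le_sq ?_ zero_le_one
    have : m * (r * (k * t)) ^ 2 ≤ m * 1 ^ 2 := by
      calc _ = κ * (k ^ 2 * (t ^ 2 * m)) := by rw [← hr2]; ring
        _ ≤ m * 1 ^ 2 := by rw [ht2]; linarith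
    exact le_of_mul_le_mul_left this hm'
  have hkt : k * t ≤ 1 / r := by rw [le_div_iff₀ hr0]; linarith
  have htr : t ≤ 1 / r := (le_mul_of_one_le_left ht0.le hk').trans hkt
  have htm : r * k ≤ t * m := by
    have : t * (r * k) ≤ t * (t * m) := by
      calc t * (r * k) = r * (k * t) := by ring
        _ ≤ 1 := hrkt
        _ ≤ d := hd'
        _ = t * (t * m) := by rw [← ht2]; ring
    exact le_of_mul_le_mul_left this ht0
  have hcont : Continuous fun x : Fin m → EuclideanSpace ℝ (Fin d) =>
      (1 + β * ‖sampleCov x - toEuclideanCLM (𝕜 := ℝ) Λ‖) ^ (2 * k) := by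
    have := continuous_sampleCov (d := d) (m := m)
    fun_prop
  have hfin : ∀ s c' : ℝ, Integrable (fun x =>
        Real.exp (s * ‖sampleCov x - toEuclideanCLM (𝕜 := ℝ) Λ‖))
        (Measure.pi fun _ : Fin m => multivariateGaussian 0 Λ) →
      (∀ x : Fin m → EuclideanSpace ℝ (Fin d),
        (1 + β * ‖sampleCov x - toEuclideanCLM (𝕜 := ℝ) Λ‖) ^ (2 * k) ≤
        c' * Real.exp (s * ‖sampleCov x - toEuclideanCLM (𝕜 := ℝ) Λ‖)) →
      Integrable (fun x => (1 + β * ‖sampleCov x - toEuclideanCLM (𝕜 := ℝ) Λ‖) ^ (2 * k))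
        (Measure.pi fun _ : Fin m => multivariateGaussian 0 Λ) ∧
      ∫ x, (1 + β * ‖sampleCov x - toEuclideanCLM (𝕜 := ℝ) Λ‖) ^ (2 * k)
        ∂(Measure.pi fun _ : Fin m => multivariateGaussian 0 Λ) ≤
        c' * ∫ x, Real.exp (s * ‖sampleCov x - toEuclideanCLM (𝕜 := ℝ) Λ‖)
          ∂(Measure.pi fun _ : Fin m => multivariateGaussian 0 Λ) := by
    intro s c' hi hle
    have hI := (hi.const_mul c').mono' hcont.aestronglyMeasurable
      (Filter.Eventually.of_forall fun x => by
        rw [Real.norm_of_nonneg (by positivity)]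
        exact hle x)
    refine ⟨hI, ?_⟩
    rw [← integral_const_mul]
    exact integral_mono hI (hi.const_mul c') hle
  -- If t is small, 1 + x ≤ exp x suffices. Otherwise t is bounded below, so k is bounded and k·t is
  -- not small: any uniform bound D on the moment is absorbed into C·k·t.
  rcases le_or_gt (9 * b * η * t) 1 with hcase | hcase
  · obtain ⟨hi, hle⟩ := integrable_exp_norm_sampleCov_sub_and_integral_le hd hm hΛ hb.le hΛb hη0
      hcase (s := 2 * k * β) (by positivity) (by
        rw [← ht, le_div_iff₀ two_pos]
        calc 2 * k * β * 2 = η * (r * k) := by rw [hη]; field_simp; ring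
          _ ≤ η * (t * m) := by gcongr
          _ = η * t * m := by ring)
    obtain ⟨h1, h2⟩ := hfin (2 * k * β) 1 hi fun x => by
      rw [one_mul]
      calc _ ≤ Real.exp (β * ‖sampleCov x - toEuclideanCLM (𝕜 := ℝ) Λ‖) ^ (2 * k) := by
            gcongr
            linarith [Real.add_one_le_exp (β * ‖sampleCov x - toEuclideanCLM (𝕜 := ℝ) Λ‖)]
        _ = _ := by
            rw [← Real.exp_nat_mul]
            congr 1
            push_cast
            ring
    refine ⟨h1, h2.trans ?_⟩
    rw [one_mul]
    have hy : 2 * (3 + 21 * η ^ 2 * b ^ 2) / η * (2 * k * β * t) = A * (k * t) := by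
      rw [hA]; ring
    rw [← ht, hy] at hle
    have hA0 : 0 < A := by positivity
    calc _ ≤ Real.exp (A * (k * t)) := hle
      _ ≤ 1 + A * (k * t) * Real.exp (A * (k * t)) := exp_le_one_add_mul_exp _
      _ ≤ 1 + A * (k * t) * Real.exp (A * (1 / r)) := by gcongr
      _ = 1 + (A * Real.exp (A * (1 / r)) + 0) * (k * t) := by ring
      _ ≤ _ := by gcongr; positivity
  · obtain ⟨hi, hle⟩ := integrable_exp_norm_sampleCov_sub_and_integral_le hd hm hΛ hb.le hΛb hη'0
      (by
        rw [← ht]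
        calc 9 * b * η' * t = r * t := by rw [hη']; field_simp
          _ ≤ r * (1 / r) := by gcongr
          _ = 1 := by field_simp)
      (s := τ) hτ0.le (by
        rw [← ht, hτ]
        calc η' * r / 2 ≤ η' * (t * m) / 2 := by
              gcongr
              exact (le_mul_of_one_le_right hr0.le hk').trans htm
          _ = _ := by ring)
    have hkN : 2 * k ≤ N := by
      have : (2 * k : ℝ) ≤ 18 * b * η / r := by
        rw [le_div_iff₀ hr0]
        nlinarith [mul_le_mul_of_nonneg_left hrkt (by positivity : 0 ≤ 18 * b * η)]
      exact_mod_cast this.trans (Nat.le_ceil _)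
    obtain ⟨h1, h2⟩ := hfin τ c hi fun x => one_add_mul_pow_le hβ hτ0 (norm_nonneg _) hkN
    refine ⟨h1, h2.trans ?_⟩
    calc _ ≤ c * Real.exp (2 * (3 + 21 * η' ^ 2 * b ^ 2) / η' * (τ * t)) := by gcongr
      _ ≤ D * 1 := by rw [mul_one, hD]; gcongr
      _ ≤ D * (9 * b * η * (k * t)) := by
          gcongr
          refine hcase.le.trans ?_
          gcongr
          exact le_mul_of_one_le_left ht0.le hk'
      _ = 0 + (0 + D * (9 * b * η)) * (k * t) := by ring
      _ ≤ _ := by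
          gcongr
          · exact zero_le_one
          · positivity

/-! ### From covariance moments to the error bound -/

theorem sqError_le {n : ℕ} {c R a : ℝ} (hn : 1 ≤ n) (hd : 1 ≤ d) (hc : c ≠ 0) (hR : 0 < R)
    (hnR : (n : ℝ) ≤ R * d) (hΛ : Λ.PosDef) (ha : 0 < a) (hΛa : ∀ i, a ≤ hΛ.1.eigenvalues i)
    (i : ℕ) (p : (Fin m → EuclideanSpace ℝ (Fin d)) × EuclideanSpace ℝ (Fin d)) :
    sqError n c Λ i p ≤ decayRate n Λ ^ (2 * i) *
      ((1 + (1 + R) * R / a * ‖sampleCov p.1 - toEuclideanCLM (𝕜 := ℝ) Λ‖) ^ (2 * i) *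
        ‖p.2‖ ^ 2) := by
  set G := toEuclideanCLM (𝕜 := ℝ) (gammaMat n Λ)⁻¹ with hG
  set T := sampleCov p.1 - toEuclideanCLM (𝕜 := ℝ) Λ with hT
  have hd' : (0 : ℝ) < d := by exact_mod_cast hd
  have hρ := inv_le_decayRate hR hnR hd hΛ
  have hρ0 := decayRate_pos n hd hΛ
  have htr : d * a ≤ Λ.trace := card_mul_le_trace hΛ.1 hΛa
  have hGn : ‖G‖ ≤ decayRate n Λ * ((1 + R) * R / a) := by
    calc ‖G‖ ≤ n / Λ.trace := norm_gammaMat_inv_le hn hd hΛ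
      _ ≤ R * d / (d * a) := by gcongr
      _ = (1 + R)⁻¹ * ((1 + R) * R / a) := by field_simp
      _ ≤ _ := by gcongr
  have hM : ‖1 - G * sampleCov p.1‖ ≤
      decayRate n Λ * (1 + (1 + R) * R / a * ‖T‖) := by
    have hsplit : 1 - G * sampleCov p.1 = (1 - G * toEuclideanCLM (𝕜 := ℝ) Λ) - G * T := by
      rw [hT, mul_sub]
      abel
    calc ‖1 - G * sampleCov p.1‖ ≤ ‖1 - G * toEuclideanCLM (𝕜 := ℝ) Λ‖ + ‖G * T‖ := by
          rw [hsplit]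
          exact norm_sub_le _ _
      _ ≤ decayRate n Λ + ‖G‖ * ‖T‖ :=
          add_le_add (norm_one_sub_gammaMat_inv_mul_le hn hd hΛ) (norm_mul_le _ _)
      _ ≤ decayRate n Λ + decayRate n Λ * ((1 + R) * R / a) * ‖T‖ := by gcongr
      _ = _ := by ring
  have hpow : ‖(1 - G * sampleCov p.1) ^ i‖ ≤
      (decayRate n Λ * (1 + (1 + R) * R / a * ‖T‖)) ^ i := by
    -- Nontriviality gives ‖1‖ = 1, needed for the power i = 0.
    have : Nontrivial (EuclideanSpace ℝ (Fin d)) := by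
      have : Nonempty (Fin d) := ⟨⟨0, hd⟩⟩
      infer_instance
    exact (norm_pow_le _ i).trans (by gcongr)
  calc sqError n c Λ i p = ‖((1 - G * sampleCov p.1) ^ i) p.2‖ ^ 2 := by
        rw [sqError, estimate_sub n hc, norm_neg]
    _ ≤ ((decayRate n Λ * (1 + (1 + R) * R / a * ‖T‖)) ^ i * ‖p.2‖) ^ 2 := by
        gcongr
        exact ContinuousLinearMap.le_of_opNorm_le _ hpow _
    _ = _ := by rw [mul_pow, mul_pow, mul_pow]; ring

theorem continuous_sqError (n : ℕ) {c : ℝ} (hc : c ≠ 0) (Λ : Matrix (Fin d) (Fin d) ℝ) (i : ℕ) :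
    Continuous (sqError (m := m) n c Λ i) := by
  have h : sqError (m := m) n c Λ i = fun p =>
      ‖((1 - toEuclideanCLM (𝕜 := ℝ) (gammaMat n Λ)⁻¹ * sampleCov p.1) ^ i) p.2‖ ^ 2 := by
    ext p
    rw [sqError, estimate_sub n hc, norm_neg]
  rw [h]
  have := continuous_sampleCov (d := d) (m := m)
  have h2 : Continuous fun p : (Fin m → EuclideanSpace ℝ (Fin d)) × EuclideanSpace ℝ (Fin d) =>
      (1 - toEuclideanCLM (𝕜 := ℝ) (gammaMat n Λ)⁻¹ * sampleCov p.1) ^ i := by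
    fun_prop
  exact (h2.clm_apply continuous_snd).norm.pow 2

theorem integrable_sqError_and_integral_le {n : ℕ} {c R a B : ℝ} (hn : 1 ≤ n) (hd : 1 ≤ d)
    (hc : c ≠ 0) (hR : 0 < R) (hnR : (n : ℝ) ≤ R * d) (hΛ : Λ.PosDef) (ha : 0 < a)
    (hΛa : ∀ i, a ≤ hΛ.1.eigenvalues i) (i : ℕ)
    (hI : Integrable (fun x => (1 + (1 + R) * R / a *
        ‖sampleCov x - toEuclideanCLM (𝕜 := ℝ) Λ‖) ^ (2 * i))
      (Measure.pi fun _ : Fin m => multivariateGaussian 0 Λ))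
    (hB : ∫ x, (1 + (1 + R) * R / a * ‖sampleCov x - toEuclideanCLM (𝕜 := ℝ) Λ‖) ^ (2 * i)
      ∂(Measure.pi fun _ : Fin m => multivariateGaussian 0 Λ) ≤ B) :
    Integrable (sqError n c Λ i) (testLaw m Λ) ∧
      ∫ p, sqError n c Λ i p ∂(testLaw m Λ) ≤ d * decayRate n Λ ^ (2 * i) * B := by
  have hdom := (hI.mul_prod (integrable_norm_sq_multivariateGaussian d)).const_mul
    (decayRate n Λ ^ (2 * i))
  have hle := sqError_le (m := m) hn hd hc hR hnR hΛ ha hΛa i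
  have hint : Integrable (sqError n c Λ i) (testLaw m Λ) :=
    hdom.mono' (continuous_sqError n hc Λ i).aestronglyMeasurable
      (Filter.Eventually.of_forall fun p => by
        rw [Real.norm_of_nonneg (by unfold sqError; positivity)]
        exact hle p)
  refine ⟨hint, (integral_mono hint hdom hle).trans ?_⟩
  have hρ0 := decayRate_pos n hd hΛ
  rw [integral_const_mul, testLaw, integral_prod_mul (fun x => (1 + (1 + R) * R / a *
    ‖sampleCov x - toEuclideanCLM (𝕜 := ℝ) Λ‖) ^ (2 * i)) (fun w => ‖w‖ ^ 2),
    integral_norm_sq_multivariateGaussian]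
  calc _ ≤ decayRate n Λ ^ (2 * i) * (B * d) := by gcongr
    _ = _ := by ring

end ICL

theorem corollary1 :
    -- the error bound, with a `1 + O(k √(d/m))` factor
    (∀ a b R κ : ℝ, 0 < a → a ≤ b → 0 < R → 0 < κ →
      ∃ C : ℝ, 0 < C ∧
        ∀ (d n m k : ℕ) (c : ℝ) (Λ : Matrix (Fin d) (Fin d) ℝ),
          1 ≤ d → 1 ≤ n → 1 ≤ k → c ≠ 0 →
          (n : ℝ) ≤ R * d →
          κ * ((k : ℝ) ^ 2 * d) ≤ m →
          Λ.PosDef → (∀ μ ∈ spectrum ℝ Λ, a ≤ μ ∧ μ ≤ b) →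
          ∀ i : ℕ, i = k ∨ i = k + 1 →
            Integrable (ICL.sqError n c Λ i) (ICL.testLaw m Λ) ∧
            ∫ p, ICL.sqError n c Λ i p ∂(ICL.testLaw m Λ) ≤
              d * (1 + (n : ℝ) / (1 + ICL.hard Λ)) ^ (-(2 * (k : ℤ))) *
                (1 + C * (k * √((d : ℝ) / m)))) ∧
    -- the bound decays exponentially in `k`
    (∀ (d n : ℕ) (Λ : Matrix (Fin d) (Fin d) ℝ), 1 ≤ d → 1 ≤ n → Λ.PosDef →
      0 < ICL.decayRate n Λ ∧ ICL.decayRate n Λ < 1) ∧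
    -- and it decays more slowly for harder tasks
    (∀ (d d' n : ℕ) (Λ : Matrix (Fin d) (Fin d) ℝ) (Λ' : Matrix (Fin d') (Fin d') ℝ),
      1 ≤ d → 1 ≤ d' → 1 ≤ n → Λ.PosDef → Λ'.PosDef → ICL.hard Λ < ICL.hard Λ' →
      ICL.decayRate n Λ < ICL.decayRate n Λ') := by
  refine ⟨fun a b R κ ha hab hR hκ => ?_,
    fun d n Λ hd hn hΛ => ⟨ICL.decayRate_pos n hd hΛ, ICL.decayRate_lt_one hn hd hΛ⟩,
    fun d d' n Λ Λ' hd _ hn hΛ _ h => ICL.decayRate_lt_decayRate hn (ICL.hard_pos hd hΛ) h⟩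
  -- The moment bound is used at order 2i with i ≤ k + 1 ≤ 2k, which costs a factor 4 in κ and a
  -- factor 2 in C.
  obtain ⟨C, hC, hmom⟩ := ICL.exists_integral_one_add_norm_pow_le (b := b)
    (β := (1 + R) * R / a) (κ := κ / 4) (ha.trans_le hab) (by positivity) (by positivity)
  refine ⟨2 * C, by positivity, ?_⟩
  intro d n m k c Λ hd hn hk hc hnR hmk hΛ hspec i hi
  have hev := fun j => hspec _ (hΛ.1.eigenvalues_mem_spectrum_real j)
  have hk' : (1 : ℝ) ≤ k := by exact_mod_cast hk
  have hki : k ≤ i := by omega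
  have hik : (i : ℝ) ≤ 2 * k := by exact_mod_cast (by omega : i ≤ 2 * k)
  have hmi : κ / 4 * ((i : ℝ) ^ 2 * d) ≤ m := by
    refine le_trans ?_ hmk
    calc κ / 4 * ((i : ℝ) ^ 2 * d) ≤ κ / 4 * ((2 * k) ^ 2 * d) := by gcongr
      _ = _ := by ring
  obtain ⟨hI, hB⟩ := hmom d m i Λ hΛ hd (hk.trans hki) hmi fun j => (hev j).2
  obtain ⟨h1, h2⟩ := ICL.integrable_sqError_and_integral_le hn hd hc hR hnR hΛ ha
    (fun j => (hev j).1) i hI hB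
  have hrate : (1 + (n : ℝ) / (1 + ICL.hard Λ)) ^ (-(2 * (k : ℤ))) =
      ICL.decayRate n Λ ^ (2 * k) := by
    rw [ICL.decayRate, inv_pow, _root_.zpow_neg]
    norm_cast
  refine ⟨h1, h2.trans ?_⟩
  rw [hrate]
  have hρ0 := ICL.decayRate_pos n hd hΛ
  -- For i = k + 1 the extra factor ρ² < 1 is discarded.
  have hpow : ICL.decayRate n Λ ^ (2 * i) ≤ ICL.decayRate n Λ ^ (2 * k) :=
    pow_le_pow_of_le_one hρ0.le (ICL.decayRate_lt_one hn hd hΛ).le (by omega)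
  have hfac : C * (i * √((d : ℝ) / m)) ≤ 2 * C * (k * √((d : ℝ) / m)) := by
    calc C * (i * √((d : ℝ) / m)) ≤ C * (2 * k * √((d : ℝ) / m)) := by gcongr
      _ = _ := by ring
  gcongr
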